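/- Let $\mathbb{K}$ be a Peano continuum (a connected, locally connected, compact metric space) with more than one point. Then there exists a continuous surjective mapping $\psi:[0,1]\to\mathbb{K}$ that is almost open, i.e. for every non-empty open subset $V$ of $[0,1]$ the image $\psi(V)$ has non-empty interior in $\mathbb{K}$. -/

import Mathlib

/-- A mapping is almost open if the image of every non-empty open set has non-empty interior. -/
def IsAlmostOpenMap {X Y : Type*} [TopologicalSpace X] [TopologicalSpace Y] (f : X → Y) : Prop :=
  ∀ V : Set X, IsOpen V → V.Nonempty → (interior (f '' V)).Nonempty

/-! The curve is a limit of chains. A chain of small connected open sets is refined by walking,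
inside each link, through the members of a finer finite cover that meet it
(`IsFineChain.exists_refinement`); connectedness of the link makes their intersection graph
connected. Matching links with equal intervals of `[0,1]`, step functions choosing a point in each
link converge uniformly to a continuous `f`. Since the refinements of a link still cover it,
compactness gives that `f` maps each interval onto a superset of its link. The first link is the
whole space, so `f` is onto; every non-empty open set contains the trace of an interval, so its
image contains a non-empty open link. -/

open Set Filter Topology

/-! ### Finite covers and walks in their intersection graphs -/

/-- A compact locally connected metric space has finite covers by small connected open sets. -/
theorem exists_finite_small_connected_open_cover {K : Type*} [MetricSpace K] [CompactSpace K]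
    [LocallyConnectedSpace K] {ε : ℝ} (hε : 0 < ε) :
    ∃ C : Set (Set K), C.Finite ∧ ⋃₀ C = univ ∧
      ∀ V ∈ C, IsOpen V ∧ IsPreconnected V ∧ ∀ x ∈ V, ∀ y ∈ V, dist x y ≤ ε := by
  let V : K → Set K := fun x ↦ connectedComponentIn (Metric.ball x (ε / 2)) x
  have hVo : ∀ x, IsOpen (V x) := fun x ↦ Metric.isOpen_ball.connectedComponentIn
  have hVx : ∀ x, x ∈ V x := fun x ↦ mem_connectedComponentIn (Metric.mem_ball_self (by positivity))
  obtain ⟨t, ht⟩ := isCompact_univ.elim_finite_subcover V hVo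
    (fun x _ ↦ mem_iUnion.2 ⟨x, hVx x⟩)
  refine ⟨V '' t, t.finite_toSet.image V, ?_, ?_⟩
  · rw [sUnion_image]
    exact univ_subset_iff.1 ht
  · rintro _ ⟨x, -, rfl⟩
    refine ⟨hVo x, isPreconnected_connectedComponentIn, fun y hy z hz ↦ ?_⟩
    have hy' := Metric.mem_ball.1 (connectedComponentIn_subset _ _ hy)
    have hz' := Metric.mem_ball.1 (connectedComponentIn_subset _ _ hz)
    linarith [dist_triangle_right y z x]

/-- In a preconnected graph, finitely many vertices can be visited by one walk with prescribed
endpoints. -/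
theorem SimpleGraph.Preconnected.exists_walk_support_superset {α : Type*} {G : SimpleGraph α}
    (hG : G.Preconnected) (a b : α) (T : Finset α) :
    ∃ p : G.Walk a b, ∀ v ∈ T, v ∈ p.support := by
  classical
  induction T using Finset.induction_on with
  | empty => exact ⟨(hG a b).some, by simp⟩
  | insert v T _ ih =>
    obtain ⟨p, hp⟩ := ih
    refine ⟨p.append ((hG b v).some.append (hG v b).some), fun u hu ↦ ?_⟩
    rw [SimpleGraph.Walk.mem_support_append_iff, SimpleGraph.Walk.mem_support_append_iff]
    rcases Finset.mem_insert.1 hu with rfl | hu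
    · exact Or.inr (Or.inl (SimpleGraph.Walk.end_mem_support _))
    · exact Or.inl (hp u hu)

/-- The intersection graph of an open cover of a preconnected set, all of whose members meet that
set, is preconnected. -/
theorem IsPreconnected.preconnected_fromRel_inter {X : Type*} [TopologicalSpace X] {U : Set X}
    (hU : IsPreconnected U) {S : Set (Set X)} (hSo : ∀ V ∈ S, IsOpen V) (hUS : U ⊆ ⋃₀ S)
    (hSU : ∀ V ∈ S, (V ∩ U).Nonempty) :
    (SimpleGraph.fromRel fun V W : S ↦ ((V : Set X) ∩ W).Nonempty).Preconnected := by
  set G := SimpleGraph.fromRel fun V W : S ↦ ((V : Set X) ∩ W).Nonempty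
  intro a b
  by_contra hab
  let A : Set X := ⋃ V : {V : S // G.Reachable a V}, (V : Set X)
  let B : Set X := ⋃ V : {V : S // ¬ G.Reachable a V}, (V : Set X)
  have hA : IsOpen A := isOpen_iUnion fun V ↦ hSo _ V.1.2
  have hB : IsOpen B := isOpen_iUnion fun V ↦ hSo _ V.1.2
  have hUAB : U ⊆ A ∪ B := by
    intro x hx
    obtain ⟨V, hV, hxV⟩ := hUS hx
    by_cases h : G.Reachable a ⟨V, hV⟩
    · exact Or.inl (mem_iUnion.2 ⟨⟨⟨V, hV⟩, h⟩, hxV⟩)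
    · exact Or.inr (mem_iUnion.2 ⟨⟨⟨V, hV⟩, h⟩, hxV⟩)
  have hUA : (U ∩ A).Nonempty := by
    obtain ⟨x, hx, hxU⟩ := hSU a a.2
    exact ⟨x, hxU, mem_iUnion.2 ⟨⟨a, .refl _⟩, hx⟩⟩
  have hUB : (U ∩ B).Nonempty := by
    obtain ⟨x, hx, hxU⟩ := hSU b b.2
    exact ⟨x, hxU, mem_iUnion.2 ⟨⟨b, hab⟩, hx⟩⟩
  obtain ⟨x, -, hxA, hxB⟩ := hU A B hA hB hUAB hUA hUB
  obtain ⟨⟨V, hV⟩, hxV⟩ := mem_iUnion.1 hxA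
  obtain ⟨⟨W, hW⟩, hxW⟩ := mem_iUnion.1 hxB
  refine hW (hV.trans ?_)
  by_cases hVW : V = W
  · exact hVW ▸ .refl _
  · exact SimpleGraph.Adj.reachable
      ((SimpleGraph.fromRel_adj _ _ _).2 ⟨hVW, Or.inl ⟨x, hxV, hxW⟩⟩)

/-- A preconnected set with a finite open cover is covered by an eventually constant chain of
members of the cover, starting and ending at prescribed members. -/
theorem IsPreconnected.exists_chain {X : Type*} [TopologicalSpace X] {U : Set X}
    (hU : IsPreconnected U) {C : Set (Set X)} (hC : C.Finite) (hCo : ∀ V ∈ C, IsOpen V)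
    (hUC : U ⊆ ⋃₀ C) {a b : Set X} (ha : a ∈ C) (hb : b ∈ C) (haU : (a ∩ U).Nonempty)
    (hbU : (b ∩ U).Nonempty) :
    ∃ (L : ℕ) (c : ℕ → Set X), c 0 = a ∧ (∀ i, L ≤ i → c i = b) ∧
      (∀ i, c i ∈ C ∧ (c i ∩ U).Nonempty ∧ (c i ∩ c (i + 1)).Nonempty) ∧
      ∀ x ∈ U, ∃ i ≤ L, x ∈ c i := by
  let S : Set (Set X) := {V ∈ C | (V ∩ U).Nonempty}
  have hS : S.Finite := hC.subset (sep_subset _ _)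
  have hUS : U ⊆ ⋃₀ S := by
    intro x hx
    obtain ⟨V, hV, hxV⟩ := hUC hx
    exact ⟨V, ⟨hV, x, hxV, hx⟩, hxV⟩
  have hG := hU.preconnected_fromRel_inter (fun V hV ↦ hCo V hV.1) hUS fun V hV ↦ hV.2
  have := hS.fintype
  obtain ⟨p, hp⟩ := hG.exists_walk_support_superset ⟨a, ha, haU⟩ ⟨b, hb, hbU⟩ Finset.univ
  refine ⟨p.length, fun i ↦ p.getVert i, by simp, fun i hi ↦ ?_, fun i ↦ ⟨(p.getVert i).2.1,
    (p.getVert i).2.2, ?_⟩, fun x hx ↦ ?_⟩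
  · simp only [p.getVert_of_length_le hi]
  · rcases lt_or_ge i p.length with hi | hi
    · rcases ((SimpleGraph.fromRel_adj _ _ _).1 (p.adj_getVert_succ hi)).2 with h | h
      · exact h
      · rwa [inter_comm]
    · simp only [p.getVert_of_length_le hi, p.getVert_of_length_le (hi.trans i.le_succ), inter_self]
      exact hbU.left
  · obtain ⟨V, hV, hxV⟩ := hUS hx
    obtain ⟨i, hi, hiL⟩ := SimpleGraph.Walk.mem_support_iff_exists_getVert.1
      (hp ⟨V, hV⟩ (Finset.mem_univ _))
    exact ⟨i, hiL, by simpa only [hi] using hxV⟩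

/-! ### Chains and their refinements -/

/-- An infinite chain, with finitely many distinct links, of connected open sets of diameter at
most `ε`. -/
structure IsFineChain {K : Type*} [MetricSpace K] (ε : ℝ) (w : ℕ → Set K) : Prop where
  finite_range : (range w).Finite
  isOpen : ∀ i, IsOpen (w i)
  isPreconnected : ∀ i, IsPreconnected (w i)
  dist_le : ∀ i, ∀ x ∈ w i, ∀ y ∈ w i, dist x y ≤ ε
  inter_nonempty : ∀ i, (w i ∩ w (i + 1)).Nonempty

/-- Every link of `w` is replaced by `N` consecutive links of `w'`, all of which meet it and which
together cover it. -/
structure IsChainRefinement {K : Type*} (w : ℕ → Set K) (N : ℕ) (w' : ℕ → Set K) : Prop where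
  inter_nonempty : ∀ j, (w' j ∩ w (j / N)).Nonempty
  exists_mem : ∀ i, ∀ x ∈ w i, ∃ j, j / N = i ∧ x ∈ w' j

/-- Consecutive walks are glued at a cover member meeting both links. Finitely many triples (link,
entry, exit) occur, so walk lengths are bounded, and repeating the last member gives every link the
same number `N` of successors. -/
theorem IsFineChain.exists_refinement {K : Type*} [MetricSpace K] [CompactSpace K]
    [LocallyConnectedSpace K] {δ ε : ℝ} {w : ℕ → Set K} (hw : IsFineChain δ w) (hε : 0 < ε) :
    ∃ (N : ℕ) (w' : ℕ → Set K), 2 ≤ N ∧ IsFineChain ε w' ∧ IsChainRefinement w N w' := by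
  obtain ⟨C, hCf, hCu, hC⟩ := exists_finite_small_connected_open_cover (K := K) hε
  -- The hypotheses sit under the existential so that `L` depends on the triple alone, not on the
  -- index `i`.
  have hex : ∀ U a b : Set K, ∃ (L : ℕ) (c : ℕ → Set K), U ∈ range w → a ∈ C → b ∈ C →
      (a ∩ U).Nonempty → (b ∩ U).Nonempty → c 0 = a ∧ (∀ i, L ≤ i → c i = b) ∧
      (∀ i, c i ∈ C ∧ (c i ∩ U).Nonempty ∧ (c i ∩ c (i + 1)).Nonempty) ∧
      ∀ x ∈ U, ∃ i ≤ L, x ∈ c i := by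
    intro U a b
    by_cases h : U ∈ range w ∧ a ∈ C ∧ b ∈ C ∧ (a ∩ U).Nonempty ∧ (b ∩ U).Nonempty
    · obtain ⟨⟨i, rfl⟩, ha, hb, haU, hbU⟩ := h
      obtain ⟨L, c, H⟩ := (hw.isPreconnected i).exists_chain hCf (fun V hV ↦ (hC V hV).1)
        (by simp [hCu]) ha hb haU hbU
      exact ⟨L, c, fun _ _ _ _ _ ↦ H⟩
    · exact ⟨0, fun _ ↦ ∅, fun h1 h2 h3 h4 h5 ↦ (h ⟨h1, h2, h3, h4, h5⟩).elim⟩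
  choose L c hc using hex
  obtain ⟨B, hB⟩ := ((hw.finite_range.prod (hCf.prod hCf)).image
    fun q : Set K × Set K × Set K ↦ L q.1 q.2.1 q.2.2).bddAbove
  have hLB : ∀ i, ∀ a ∈ C, ∀ b ∈ C, L (w i) a b ≤ B := fun i a ha b hb ↦
    hB ⟨(w i, a, b), ⟨⟨i, rfl⟩, ha, hb⟩, rfl⟩
  have hexit : ∀ i, ∃ E ∈ C, (E ∩ w i).Nonempty ∧ (E ∩ w (i + 1)).Nonempty := by
    intro i
    obtain ⟨x, hx, hx'⟩ := hw.inter_nonempty i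
    obtain ⟨E, hE, hxE⟩ : x ∈ ⋃₀ C := hCu ▸ mem_univ x
    exact ⟨E, hE, ⟨x, hxE, hx⟩, ⟨x, hxE, hx'⟩⟩
  choose e heC he he' using hexit
  -- At `i = 0` truncated subtraction makes the entry `e 0`, which also meets `w 0`.
  have hentry : ∀ i, (e (i - 1) ∩ w i).Nonempty := by
    rintro (_ | i)
    · exact he 0
    · exact he' i
  have H := fun i ↦ hc (w i) (e (i - 1)) (e i) ⟨i, rfl⟩ (heC _) (heC _) (hentry i) (he i)
  -- `B + 1` positions already complete every walk; one more ensures `2 ≤ N`.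
  let N := B + 2
  have hN : 0 < N := by omega
  let w' : ℕ → Set K := fun j ↦ c (w (j / N)) (e (j / N - 1)) (e (j / N)) (j % N)
  have hw'C : ∀ j, w' j ∈ C := fun j ↦ ((H (j / N)).2.2.1 (j % N)).1
  refine ⟨N, w', by omega, ⟨?_, fun j ↦ (hC _ (hw'C j)).1, fun j ↦ (hC _ (hw'C j)).2.1,
    fun j ↦ (hC _ (hw'C j)).2.2, fun j ↦ ?_⟩, fun j ↦ ((H (j / N)).2.2.1 (j % N)).2.1, ?_⟩
  · exact hCf.subset (range_subset_iff.2 hw'C)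
  · have hj := Nat.div_add_mod j N
    have hlt := Nat.mod_lt j hN
    rcases Nat.lt_or_ge (j % N + 1) N with h | h
    · have hj' : j + 1 = j % N + 1 + N * (j / N) := by omega
      have h1 : (j + 1) / N = j / N := by
        rw [hj', Nat.add_mul_div_left _ _ hN, Nat.div_eq_of_lt h, zero_add]
      have h2 : (j + 1) % N = j % N + 1 := by
        rw [hj', Nat.add_mul_mod_self_left, Nat.mod_eq_of_lt h]
      simp only [w', h1, h2]
      exact ((H (j / N)).2.2.1 (j % N)).2.2
    · have hj' : j + 1 = N * (j / N + 1) := by rw [mul_add]; omega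
      have h1 : (j + 1) / N = j / N + 1 := by rw [hj', Nat.mul_div_cancel_left _ hN]
      have h2 : (j + 1) % N = 0 := by rw [hj', Nat.mul_mod_right]
      have hle := hLB (j / N) _ (heC (j / N - 1)) _ (heC (j / N))
      have h3 : w' j = e (j / N) := (H (j / N)).2.1 (j % N) (by omega)
      have h4 : w' (j + 1) = e (j / N) := by
        simp only [w', h1, h2]
        exact (H (j / N + 1)).1
      rw [h3, h4, inter_self]
      exact (he _).left
  · intro i x hx
    obtain ⟨r, hr, hxr⟩ := (H i).2.2.2 x hx
    have hle := hLB i _ (heC (i - 1)) _ (heC i)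
    have hrN : r < N := by omega
    have h1 : (r + N * i) / N = i := by
      rw [Nat.add_mul_div_left _ _ hN, Nat.div_eq_of_lt hrN, zero_add]
    have h2 : (r + N * i) % N = r := by rw [Nat.add_mul_mod_self_left, Nat.mod_eq_of_lt hrN]
    refine ⟨r + N * i, h1, ?_⟩
    simp only [w', h1, h2]
    exact hxr

/-- In a Peano continuum there is a sequence of successively refined chains with geometrically
decreasing mesh, whose first chain is constantly the whole space. -/
theorem exists_seq_chainRefinement (K : Type*) [MetricSpace K] [CompactSpace K]
    [ConnectedSpace K] [LocallyConnectedSpace K] :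
    ∃ (D : ℝ) (N : ℕ → ℕ) (w : ℕ → ℕ → Set K), 0 < D ∧ (∀ i, w 0 i = univ) ∧ (∀ n, 2 ≤ N n) ∧
      (∀ n, IsFineChain (D * (1 / 2) ^ n) (w n)) ∧
      ∀ n, IsChainRefinement (w n) (N n) (w (n + 1)) := by
  obtain ⟨D, hD, hdist⟩ : ∃ D : ℝ, 0 < D ∧ ∀ x y : K, dist x y ≤ D := by
    refine ⟨Metric.diam (univ : Set K) + 1, by positivity, fun x y ↦ ?_⟩
    linarith [Metric.dist_le_diam_of_mem isCompact_univ.isBounded (mem_univ x) (mem_univ y)]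
  have step : ∀ (n : ℕ) (w : {w : ℕ → Set K // IsFineChain (D * (1 / 2) ^ n) w}),
      ∃ (w' : {w' : ℕ → Set K // IsFineChain (D * (1 / 2) ^ (n + 1)) w'}) (N : ℕ),
        2 ≤ N ∧ IsChainRefinement w.1 N w'.1 := by
    intro n w
    obtain ⟨N, w', hN, hw', h⟩ :=
      w.2.exists_refinement (show 0 < D * (1 / 2) ^ (n + 1) by positivity)
    exact ⟨⟨w', hw'⟩, N, hN, h⟩
  choose next M hM hnext using step
  have h0 : IsFineChain (D * (1 / 2) ^ 0) (fun _ : ℕ ↦ (univ : Set K)) :=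
    ⟨finite_range_const, fun _ ↦ isOpen_univ, fun _ ↦ isPreconnected_univ,
      fun _ x _ y _ ↦ by simpa using hdist x y, fun _ ↦ by simp⟩
  let W : ∀ n, {w : ℕ → Set K // IsFineChain (D * (1 / 2) ^ n) w} :=
    fun n ↦ Nat.rec ⟨_, h0⟩ next n
  exact ⟨D, fun n ↦ M n (W n), fun n ↦ (W n).1, hD, fun _ ↦ rfl, fun n ↦ hM n _,
    fun n ↦ (W n).2, fun n ↦ hnext n _⟩

/-! ### The limit curve -/

/-- If the links of a chain of level `n` are matched with the intervals of length `1 / m n`, the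
refined chains converge to a continuous curve, which on each such interval covers the
corresponding link. -/
theorem exists_continuous_image_superset {K : Type*} [MetricSpace K] [CompactSpace K] {D : ℝ}
    {N m : ℕ → ℕ} {w : ℕ → ℕ → Set K} (hm : ∀ n, 0 < m n)
    (hmN : ∀ n, m (n + 1) = m n * N n) (hD : 0 < D)
    (hw : ∀ n, IsFineChain (D * (1 / 2) ^ n) (w n))
    (href : ∀ n, IsChainRefinement (w n) (N n) (w (n + 1))) :
    ∃ f : ℝ → K, ContinuousOn f (Ici 0) ∧
      ∀ n i, w n i ⊆ f '' Icc ((i : ℝ) / m n) ((i + 1 : ℝ) / m n) := by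
  have hm' : ∀ n, (0 : ℝ) < m n := fun n ↦ by exact_mod_cast hm n
  have hN : ∀ n, 0 < N n := fun n ↦ by
    have := hm (n + 1)
    rw [hmN] at this
    exact Nat.pos_of_mul_pos_left this
  choose p hp using fun n i ↦ ((hw n).inter_nonempty i).left
  let P : ℕ → ℝ → K := fun n t ↦ p n ⌊t * m n⌋₊
  have hfloor : ∀ n (t : ℝ), ⌊t * m (n + 1)⌋₊ / N n = ⌊t * m n⌋₊ := by
    intro n t
    have h : (N n : ℝ) ≠ 0 := by exact_mod_cast (hN n).ne'
    rw [← Nat.floor_div_natCast, hmN]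
    congr 1
    push_cast
    field_simp
  have hstep : ∀ t n, dist (P n t) (P (n + 1) t) ≤ (2 * D) * (1 / 2) ^ n := by
    intro t n
    obtain ⟨x, hx', hx⟩ := (href n).inter_nonempty ⌊t * m (n + 1)⌋₊
    rw [hfloor] at hx
    have h1 := (hw n).dist_le _ _ (hp n ⌊t * m n⌋₊) x hx
    have h2 := (hw (n + 1)).dist_le _ x hx' _ (hp (n + 1) ⌊t * m (n + 1)⌋₊)
    have h3 : D * (1 / 2 : ℝ) ^ (n + 1) ≤ D * (1 / 2) ^ n := by
      rw [pow_succ]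
      have : 0 < D * (1 / 2 : ℝ) ^ n := by positivity
      linarith
    have h4 := dist_triangle (P n t) x (P (n + 1) t)
    linarith
  choose f hf using fun t ↦ cauchySeq_tendsto_of_complete
    (cauchySeq_of_le_geometric (1 / 2 : ℝ) (2 * D) (by norm_num) (hstep t))
  have hPf : ∀ t n, dist (P n t) (f t) ≤ 4 * D * (1 / 2) ^ n := by
    intro t n
    have := dist_le_of_le_geometric_of_tendsto (1 / 2 : ℝ) (2 * D) (by norm_num) (hstep t)
      (hf t) n
    convert this using 1
    ring
  -- The constant is `4 + 2 + 4`: two limit errors `hPf` and one jump `hadj` between adjacent links.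
  have hlim : Tendsto (fun n : ℕ ↦ 10 * D * (1 / 2 : ℝ) ^ n) atTop (𝓝 0) := by
    simpa using (tendsto_pow_atTop_nhds_zero_of_lt_one (by norm_num : (0 : ℝ) ≤ 1 / 2)
      (by norm_num)).const_mul (10 * D)
  have hadj : ∀ n i j, i ≤ j → j ≤ i + 1 → dist (p n i) (p n j) ≤ 2 * D * (1 / 2) ^ n := by
    intro n i j hij hji
    obtain rfl | rfl : j = i ∨ j = i + 1 := by omega
    · rw [dist_self]
      positivity
    · obtain ⟨x, hx, hx'⟩ := (hw n).inter_nonempty i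
      have h1 := (hw n).dist_le _ _ (hp n i) x hx
      have h2 := (hw n).dist_le _ x hx' _ (hp n (i + 1))
      linarith [dist_triangle (p n i) x (p n (i + 1))]
  have hadj' : ∀ n (s t : ℝ), 0 ≤ s → s ≤ t → t < s + 1 / m n →
      dist (f s) (f t) ≤ 10 * D * (1 / 2) ^ n := by
    intro n s t hs hst hts
    have h1 : ⌊s * m n⌋₊ ≤ ⌊t * m n⌋₊ := by gcongr
    have h2 : ⌊t * m n⌋₊ ≤ ⌊s * m n⌋₊ + 1 := by
      rw [← Nat.floor_add_one (by have := hm' n; positivity)]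
      apply Nat.floor_le_floor
      calc t * m n ≤ (s + 1 / m n) * m n := by gcongr
        _ = s * m n + 1 := by have := (hm' n).ne'; field_simp
    have h3 : dist (P n s) (P n t) ≤ 2 * D * (1 / 2) ^ n := hadj n _ _ h1 h2
    have h4 := hPf s n
    rw [dist_comm] at h4
    linarith [hPf t n, dist_triangle4 (f s) (P n s) (P n t) (f t)]
  have hcont : ContinuousOn f (Ici 0) := by
    rw [Metric.continuousOn_iff]
    intro t ht ε hε
    obtain ⟨n, hn⟩ := (hlim.eventually_lt_const hε).exists
    refine ⟨1 / m n, by have := hm' n; positivity, fun s hs hst ↦ ?_⟩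
    rw [Real.dist_eq, abs_lt] at hst
    rcases le_total s t with h | h
    · exact (hadj' n s t hs h (by linarith)).trans_lt hn
    · rw [dist_comm]
      exact (hadj' n t s ht h (by linarith)).trans_lt hn
  refine ⟨f, hcont, fun n i u hu ↦ ?_⟩
  -- Following `u` down the refinements keeps the matched intervals inside the original one, so `u`
  -- is a limit of values of `f` there.
  have hsub : ∀ k, n ≤ k → ∃ j : ℕ, u ∈ w k j ∧ (i : ℝ) / m n ≤ (j : ℝ) / m k ∧
      (j + 1 : ℝ) / m k ≤ (i + 1 : ℝ) / m n := by
    intro k hk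
    induction k, hk using Nat.le_induction with
    | base => exact ⟨i, hu, le_rfl, le_rfl⟩
    | succ k _ ih =>
      obtain ⟨j, hj, hij, hji⟩ := ih
      obtain ⟨l, hl, hul⟩ := (href k).exists_mem j u hj
      have hk0 := hm' k
      have hN0 : (0 : ℝ) < N k := by exact_mod_cast hN k
      have h1 : (j * N k : ℝ) ≤ l := by
        exact_mod_cast hl ▸ Nat.div_mul_le_self l (N k)
      have h2 : (l + 1 : ℝ) ≤ (j + 1) * N k := by
        exact_mod_cast (Nat.div_lt_iff_lt_mul (hN k)).1 (by omega : l / N k < j + 1)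
      refine ⟨l, hul, hij.trans ?_, le_trans ?_ hji⟩
      · rw [hmN]
        push_cast
        rw [div_le_div_iff₀ hk0 (by positivity)]
        nlinarith
      · rw [hmN]
        push_cast
        rw [div_le_div_iff₀ (by positivity) hk0]
        nlinarith
  have hIcc : Icc ((i : ℝ) / m n) ((i + 1 : ℝ) / m n) ⊆ Ici 0 := fun t ht ↦
    le_trans (by positivity) ht.1
  have hclosed := (isCompact_Icc.image_of_continuousOn (hcont.mono hIcc)).isClosed
  rw [← hclosed.closure_eq, Metric.mem_closure_iff]
  intro ε hε
  obtain ⟨k, hk, hnk⟩ := ((hlim.eventually_lt_const hε).and (eventually_ge_atTop n)).exists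
  obtain ⟨j, hj, hij, hji⟩ := hsub k hnk
  refine ⟨f (j / m k), ⟨_, ⟨hij, le_trans ?_ hji⟩, rfl⟩, ?_⟩
  · have := hm' k
    gcongr
    linarith
  · have hP : P k (j / m k) = p k j := by
      simp only [P]
      rw [div_mul_cancel₀ _ (hm' k).ne', Nat.floor_natCast]
    have h1 := hPf (j / m k) k
    rw [hP] at h1
    have h2 := (hw k).dist_le j u hj _ (hp k j)
    have : 0 < D * (1 / 2 : ℝ) ^ k := by positivity
    linarith [dist_triangle u (p k j) (f (j / m k))]

theorem lemma8 {K : Type*} [MetricSpace K] [CompactSpace K] [ConnectedSpace K]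
    [LocallyConnectedSpace K] [Nontrivial K] :
    ∃ ψ : unitInterval → K, Continuous ψ ∧ Function.Surjective ψ ∧ IsAlmostOpenMap ψ := by
  obtain ⟨D, N, w, hD, hw0, hN, hw, href⟩ := exists_seq_chainRefinement K
  let m : ℕ → ℕ := fun n ↦ ∏ k ∈ Finset.range n, N k
  have hm2 : ∀ n, 2 ^ n ≤ m n := fun n ↦ by
    simpa using Finset.pow_card_le_prod (Finset.range n) N 2 fun k _ ↦ hN k
  have hm : ∀ n, 0 < m n := fun n ↦ (by positivity : 0 < 2 ^ n).trans_le (hm2 n)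
  obtain ⟨f, hf, hfw⟩ := exists_continuous_image_superset hm
    (fun n ↦ Finset.prod_range_succ N n) hD hw href
  refine ⟨fun t ↦ f t, hf.comp_continuous continuous_subtype_val fun t ↦ t.2.1, fun u ↦ ?_, ?_⟩
  · obtain ⟨t, ht, rfl⟩ := hfw 0 0 (hw0 0 ▸ mem_univ u)
    exact ⟨⟨t, by simpa [m] using ht⟩, rfl⟩
  · rintro V hV ⟨t, ht⟩
    obtain ⟨ε, hε, hball⟩ := Metric.isOpen_iff.1 hV t ht
    obtain ⟨n, hn⟩ := exists_pow_lt_of_lt_one hε (by norm_num : (1 / 2 : ℝ) < 1)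
    have hm0 : (0 : ℝ) < m n := by exact_mod_cast hm n
    have hmε : 1 / (m n : ℝ) < ε := by
      refine lt_of_le_of_lt ?_ hn
      rw [one_div_pow]
      have := hm2 n
      gcongr
      exact_mod_cast this
    obtain ⟨i, him, hit, hti⟩ : ∃ i : ℕ, i + 1 ≤ m n ∧ (i : ℝ) / m n ≤ t ∧
        (t : ℝ) ≤ (i + 1 : ℝ) / m n := by
      have ht0 : 0 ≤ (t : ℝ) * m n := mul_nonneg t.2.1 hm0.le
      rcases Nat.lt_or_ge ⌊(t : ℝ) * m n⌋₊ (m n) with h | h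
      · refine ⟨_, h, ?_, ?_⟩
        · rw [div_le_iff₀ hm0]
          exact Nat.floor_le ht0
        · rw [le_div_iff₀ hm0]
          exact (Nat.lt_floor_add_one _).le
      -- Only `t = 1` falls here; it belongs to the last interval.
      · have h1 : (m n : ℝ) ≤ t * m n := (Nat.le_floor_iff ht0).1 h
        have hpred : ((m n - 1 : ℕ) : ℝ) = m n - 1 := by
          rw [Nat.cast_sub (hm n), Nat.cast_one]
        refine ⟨m n - 1, by have := hm n; omega, ?_, ?_⟩
        · rw [div_le_iff₀ hm0]
          linarith
        · rw [le_div_iff₀ hm0]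
          nlinarith [t.2.2]
    have hsub : w n i ⊆ (fun t : unitInterval ↦ f t) '' V := by
      refine (hfw n i).trans ?_
      rintro _ ⟨s, ⟨his, hsi⟩, rfl⟩
      have hs : s ∈ unitInterval := by
        refine ⟨le_trans (by positivity) his, hsi.trans ?_⟩
        rw [div_le_one hm0]
        exact_mod_cast him
      refine ⟨⟨s, hs⟩, hball ?_, rfl⟩
      rw [Metric.mem_ball, Subtype.dist_eq, Real.dist_eq]
      refine lt_of_le_of_lt ?_ hmε
      rw [add_div] at hsi hti
      rw [abs_le]
      constructor <;> linarith
    exact ((hw n).inter_nonempty i).left.mono (interior_maximal hsub ((hw n).isOpen i))
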